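/- Proposition 9.1 (Lions' formula). Let $d\ge 1$, let $\Omega\subset\mathbb R^d$ be a bounded Lipschitz domain (open, connected, bounded, and near each boundary point, in suitable orthonormal coordinates, the region above the graph of a Lipschitz function, with $\partial\Omega$ given by the graph), let $\sigma$ be the surface measure on $\partial\Omega$, and let all functions be real. Let $\mathcal H(\Omega)=\{v\in L^2(\Omega):\Delta v=0\text{ in }\mathscr D'(\Omega)\}$ be the harmonic Bergman space, with the inner product of $L^2(\Omega)$. (a) Every $v\in\mathcal H(\Omega)$ is represented by a harmonic function on $\Omega$ (necessarily unique); $v(x)$ denotes its value at $x$. For every $x\in\Omega$ there is a (necessarily unique) $b_x\in\mathcal H(\Omega)$ with $v(x)=(b_x,v)_{L^2(\Omega)}$ for all $v\in\mathcal H(\Omega)$. So the Bergman kernel $b(x,y)=b_x(y)$ satisfies $v(x)=\int_\Omega b(x,y)v(y)\,dy$ for all $x\in\Omega$ and $v\in\mathcal H(\Omega)$, and for every orthonormal basis $(\phi_n)$ of $\mathcal H(\Omega)$ one has $b(x,y)=\sum_n\phi_n(x)\phi_n(y)$ for all $x,y\in\Omega$. (b) Let $A:L^2(\partial\Omega)\to\mathcal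 H(\Omega)$ be a bounded linear operator with adjoint $A^*$. Then for every $v$ in the range $\mathcal R(A)$ there is $g\in L^2(\partial\Omega)$ such that $$v(x)=\int_{\partial\Omega}(A^*b_x)(y)\,g(y)\,d\sigma(y)\qquad\text{for all }x\in\Omega,$$ the integrand being integrable. (c) Let $K:L^2(\partial\Omega)\to L^2(\Omega)$ be the solution operator of the Dirichlet problem, that is, a bounded linear operator such that for each $g\in L^2(\partial\Omega)$ the function $v=Kg$ is a very weak solution of $\Delta v=0$ in $\Omega$, $v=g$ on $\partial\Omega$: $$\int_\Omega v\,\Delta u\,dx=\int_{\partial\Omega}g\,\partial_\nu u\,d\sigma$$ for all $u\in H^1_0(\Omega)$ with $\Delta u\in L^2(\Omega)$ and $\partial_\nu u\in L^2(\partial\Omega)$, where $\partial_\nu u$ is the normal derivative in the sense of Green's formula $\int_\Omega\nabla u\cdot\nabla w\,dx=-\int_\Omega \Delta u\,w\,dx+\int_{\partial\Omega}\partial_\nu u\,w\,d\sigma$ for all $w\in C_c^\infty(\mathbb R^d)$. Then $\mathcal R(K)\subset\mathcal H(\Omega)$, and for every $v\in\mathcal R(K)$ there is $g\in L^2(\partial\Omega)$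 such that (Lions' formula) $$v(x)=\int_{\partial\Omega}(K^*b_x)(y)\,g(y)\,d\sigma(y)\qquad\text{for all }x\in\Omega,$$ the integrand being integrable. -/

import Mathlib

open MeasureTheory Filter Topology InnerProductSpace
open scoped ENNReal ContDiff Laplacian Gradient

noncomputable section

/-- The domains of the theory: nonempty, bounded, open, connected sets `Ω ⊆ ℝᵈ` whose boundary is
Lipschitz continuous. Near each boundary point `x` there are orthonormal coordinates
`y = (ŷ, y_d)`, where `y_d = ⟪e, y⟫` is the component along a unit vector `e` and
`ŷ = y - ⟪e, y⟫ e` is the projection to the hyperplane orthogonal to `e`, and a Lipschitz function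
`γ` of `ŷ`, such that inside the cylinder `‖ŷ - x̂‖ < δ`, `|y_d - x_d| < δ'` the set `Ω` is
`{γ(ŷ) < y_d}` and its boundary is `{γ(ŷ) = y_d}`. (The values of `γ` off the hyperplane are
irrelevant.) -/
structure IsBoundedLipschitzDomain {d : ℕ} (Ω : Set (EuclideanSpace ℝ (Fin d))) : Prop where
  isOpen : IsOpen Ω
  isConnected : IsConnected Ω
  isBounded : Bornology.IsBounded Ω
  lipschitz_boundary : ∀ x ∈ frontier Ω,
    ∃ (e : EuclideanSpace ℝ (Fin d)) (γ : EuclideanSpace ℝ (Fin d) → ℝ) (L : NNReal) (δ δ' : ℝ),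
      ‖e‖ = 1 ∧ LipschitzWith L γ ∧ 0 < δ ∧ 0 < δ' ∧
      ∀ y : EuclideanSpace ℝ (Fin d),
        ‖(y - x) - inner ℝ e (y - x) • e‖ < δ → |inner ℝ e (y - x)| < δ' →
          ((y ∈ Ω ↔ γ (y - inner ℝ e y • e) < inner ℝ e y) ∧
            (y ∈ frontier Ω ↔ γ (y - inner ℝ e y • e) = inner ℝ e y))

/-- The surface measure `σ` on `∂Ω`: the `(d-1)`-dimensional Hausdorff measure, normalized so as to
agree with Lebesgue measure on `ℝᵈ⁻¹`, restricted to `∂Ω`. -/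
def surfaceMeasure {d : ℕ} (Ω : Set (EuclideanSpace ℝ (Fin d))) :
    Measure (EuclideanSpace ℝ (Fin d)) :=
  (Measure.euclideanHausdorffMeasure (d - 1)).restrict (frontier Ω)

/-- The real Hilbert space `L²(Ω)`. -/
abbrev L2Domain {d : ℕ} (Ω : Set (EuclideanSpace ℝ (Fin d))) :=
  Lp ℝ 2 (volume.restrict Ω)

/-- The real Hilbert space `L²(∂Ω)`. -/
abbrev L2Boundary {d : ℕ} (Ω : Set (EuclideanSpace ℝ (Fin d))) :=
  Lp ℝ 2 (surfaceMeasure Ω)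

/-- Real test functions on an open set `U`. -/
structure IsTestFunction {d : ℕ} (U : Set (EuclideanSpace ℝ (Fin d)))
    (φ : EuclideanSpace ℝ (Fin d) → ℝ) : Prop where
  contDiff : ContDiff ℝ ∞ φ
  hasCompactSupport : HasCompactSupport φ
  tsupport_subset : tsupport φ ⊆ U

theorem IsTestFunction.memLp_laplacian {d : ℕ} {U : Set (EuclideanSpace ℝ (Fin d))}
    {φ : EuclideanSpace ℝ (Fin d) → ℝ} (h : IsTestFunction U φ)
    (μ : Measure (EuclideanSpace ℝ (Fin d))) [IsFiniteMeasureOnCompacts μ] :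
    MemLp (Δ φ) 2 μ := by
  have hL := laplacian_eq_iteratedFDeriv_stdOrthonormalBasis φ
  have hcont : Continuous (Δ φ) := by
    have h2 : Continuous (iteratedFDeriv ℝ 2 φ) :=
      (contDiff_infty.mp h.contDiff 2).continuous_iteratedFDeriv le_rfl
    rw [hL]
    fun_prop
  have hsupp : HasCompactSupport (Δ φ) := by
    refine (h.hasCompactSupport.iteratedFDeriv (𝕜 := ℝ) 2).mono fun x hx hx0 => hx ?_
    rw [hL]
    simp [hx0]
  exact hcont.memLp_of_hasCompactSupport hsupp

/-- The distribution `Δ u` on `Ω` is the function `f`. -/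
def HasWeakLaplacian {d : ℕ} (Ω : Set (EuclideanSpace ℝ (Fin d)))
    (u f : EuclideanSpace ℝ (Fin d) → ℝ) : Prop :=
  ∀ φ, IsTestFunction Ω φ → ∫ x in Ω, u x * (Δ φ) x = ∫ x in Ω, f x * φ x

/-- The harmonic Bergman space `𝓗(Ω) = {v ∈ L²(Ω) : Δ v = 0 in 𝓓'(Ω)}`, with the inner product of
`L²(Ω)`. -/
def bergmanSpace {d : ℕ} (Ω : Set (EuclideanSpace ℝ (Fin d))) : Submodule ℝ (L2Domain Ω) where
  carrier := {v | HasWeakLaplacian Ω v 0}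
  zero_mem' := by
    intro φ _
    have h0 : (fun x => ((0 : L2Domain Ω) : EuclideanSpace ℝ (Fin d) → ℝ) x * (Δ φ) x)
        =ᵐ[volume.restrict Ω] fun _ => 0 := by
      filter_upwards [Lp.coeFn_zero ℝ 2 (volume.restrict Ω)] with x hx
      rw [hx, Pi.zero_apply, zero_mul]
    rw [integral_congr_ae h0]
    simp
  add_mem' := by
    intro u v hu hv φ hφ
    have hu' := hu φ hφ
    have hv' := hv φ hφ
    simp only [Pi.zero_apply, zero_mul, integral_zero] at hu' hv' ⊢
    have h := hφ.memLp_laplacian (volume.restrict Ω)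
    have hiu : Integrable (fun x => u x * (Δ φ) x) (volume.restrict Ω) :=
      (Lp.memLp u).integrable_mul h
    have hiv : Integrable (fun x => v x * (Δ φ) x) (volume.restrict Ω) :=
      (Lp.memLp v).integrable_mul h
    rw [integral_congr_ae (g := fun x => u x * (Δ φ) x + v x * (Δ φ) x),
      integral_add hiu hiv, hu', hv', add_zero]
    filter_upwards [Lp.coeFn_add u v] with x hx
    rw [hx, Pi.add_apply, add_mul]
  smul_mem' := by
    intro c u hu φ hφ
    have hu' := hu φ hφ
    simp only [Pi.zero_apply, zero_mul, integral_zero] at hu' ⊢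
    rw [integral_congr_ae (g := fun x => c * (u x * (Δ φ) x)), integral_const_mul, hu', mul_zero]
    filter_upwards [Lp.coeFn_smul c u] with x hx
    rw [hx, Pi.smul_apply, smul_eq_mul, mul_assoc]

theorem isClosed_bergmanSpace {d : ℕ} (Ω : Set (EuclideanSpace ℝ (Fin d))) :
    IsClosed (bergmanSpace Ω : Set (L2Domain Ω)) := by
  have key : (bergmanSpace Ω : Set (L2Domain Ω)) =
      ⋂ (φ : EuclideanSpace ℝ (Fin d) → ℝ) (h : IsTestFunction Ω φ),
        {v : L2Domain Ω | inner ℝ ((h.memLp_laplacian (volume.restrict Ω)).toLp (Δ φ)) v = 0} := by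
    ext v
    simp only [Set.mem_iInter, Set.mem_ofPred_eq]
    refine forall_congr' fun φ => forall_congr' fun h => ?_
    have e : inner ℝ ((h.memLp_laplacian (volume.restrict Ω)).toLp (Δ φ)) v =
        ∫ x in Ω, v x * (Δ φ) x := by
      rw [L2.inner_def]
      refine integral_congr_ae ?_
      filter_upwards [(h.memLp_laplacian (volume.restrict Ω)).coeFn_toLp] with x hx
      simp [hx]
    rw [e]
    simp
  rw [key]
  exact isClosed_iInter fun φ => isClosed_iInter fun h =>
    isClosed_eq (by fun_prop) continuous_const

instance {d : ℕ} (Ω : Set (EuclideanSpace ℝ (Fin d))) : CompleteSpace (bergmanSpace Ω) :=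
  (isClosed_bergmanSpace Ω).completeSpace_coe

open Classical in
/-- The harmonic function on `Ω` that represents the class `v ∈ 𝓗(Ω)`. It is unique on the open set
`Ω`; the fallback value `0` is used only if there were none. -/
def bergmanRep {d : ℕ} (Ω : Set (EuclideanSpace ℝ (Fin d))) (v : bergmanSpace Ω) :
    EuclideanSpace ℝ (Fin d) → ℝ :=
  if h : ∃ f : EuclideanSpace ℝ (Fin d) → ℝ,
      HarmonicOnNhd f Ω ∧ ((v : L2Domain Ω) : EuclideanSpace ℝ (Fin d) → ℝ) =ᵐ[volume.restrict Ω] f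
  then h.choose else 0

open Classical in
/-- The Bergman kernel as a vector `b_x ∈ 𝓗(Ω)`: the Riesz representative of the evaluation
`v ↦ v(x)`. The fallback value `0` is used only if the evaluation were not represented. -/
def bergmanKernel {d : ℕ} (Ω : Set (EuclideanSpace ℝ (Fin d))) (x : EuclideanSpace ℝ (Fin d)) :
    bergmanSpace Ω :=
  if h : ∃ k : bergmanSpace Ω, ∀ v : bergmanSpace Ω, inner ℝ k v = bergmanRep Ω v x
  then h.choose else 0

/-- `u ∈ H¹₀(Ω)` with (weak) gradient `G`: the pair `(u, G)` is a limit in `L²(Ω)` of pairs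
`(φ, ∇φ)` with test functions `φ` on `Ω`. -/
def MemH10 {d : ℕ} (Ω : Set (EuclideanSpace ℝ (Fin d)))
    (u : EuclideanSpace ℝ (Fin d) → ℝ)
    (G : EuclideanSpace ℝ (Fin d) → EuclideanSpace ℝ (Fin d)) : Prop :=
  MemLp u 2 (volume.restrict Ω) ∧ MemLp G 2 (volume.restrict Ω) ∧
  ∃ φ : ℕ → EuclideanSpace ℝ (Fin d) → ℝ, (∀ n, IsTestFunction Ω (φ n)) ∧
    Tendsto (fun n => eLpNorm (φ n - u) 2 (volume.restrict Ω)) atTop (𝓝 0) ∧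
    Tendsto (fun n => eLpNorm (∇ (φ n) - G) 2 (volume.restrict Ω)) atTop (𝓝 0)

/-- For `u ∈ H¹(Ω)` with gradient `G` and Laplacian `f ∈ L²(Ω)`, the normal derivative `∂_ν u` is the
function `h ∈ L²(∂Ω)`, in the sense of Green's formula
`∫_Ω ∇u · ∇w dx = - ∫_Ω Δu w dx + ∫_∂Ω (∂_ν u) w dσ`, tested with the restrictions to `Ω` of
`w ∈ C_c^∞(ℝᵈ)`, which are dense in `H¹(Ω)` for a Lipschitz domain. -/
def HasNormalDerivative {d : ℕ} (Ω : Set (EuclideanSpace ℝ (Fin d)))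
    (G : EuclideanSpace ℝ (Fin d) → EuclideanSpace ℝ (Fin d))
    (f : EuclideanSpace ℝ (Fin d) → ℝ) (h : L2Boundary Ω) : Prop :=
  ∀ w, IsTestFunction Set.univ w →
    ∫ x in Ω, inner ℝ (G x) (∇ w x) =
      -(∫ x in Ω, f x * w x) + ∫ y, h y * w y ∂(surfaceMeasure Ω)

/-- `v ∈ L²(Ω)` is the very weak solution of the Dirichlet problem `Δ v = 0` in `Ω`, `v = g` on `∂Ω`,
for `g ∈ L²(∂Ω)`: `∫_Ω v Δu dx = ∫_∂Ω g ∂_ν u dσ` for all `u ∈ H¹₀(Ω)` with `Δu ∈ L²(Ω)` (and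
`∂_ν u ∈ L²(∂Ω)`, so that the boundary integral makes sense). -/
def IsVeryWeakDirichletSolution {d : ℕ} (Ω : Set (EuclideanSpace ℝ (Fin d)))
    (g : L2Boundary Ω) (v : L2Domain Ω) : Prop :=
  ∀ (u : EuclideanSpace ℝ (Fin d) → ℝ)
    (G : EuclideanSpace ℝ (Fin d) → EuclideanSpace ℝ (Fin d))
    (f : EuclideanSpace ℝ (Fin d) → ℝ) (h : L2Boundary Ω),
    MemH10 Ω u G → MemLp f 2 (volume.restrict Ω) → HasWeakLaplacian Ω u f →
    HasNormalDerivative Ω G f h →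
      ∫ x in Ω, v x * f x = ∫ y, g y * h y ∂(surfaceMeasure Ω)

end

/-!
The substance of the statement is Weyl's lemma together with the boundedness of point evaluations on
`𝓗(Ω)`; what remains is Hilbert space algebra.

Weyl's lemma is obtained from radial means. Let `κ_p(z) = c pⁿ f(p² ‖z‖²)` be a smooth radial
probability density supported in the ball of radius `1 / p`. Its derivative in `p` is the divergence
of a radial field, hence the Laplacian of a function supported in the same ball
(`laplacian_radialPotential`). If `v` is weakly harmonic, the derivative in `p` of
`∫ v(y) κ_p(y - x) dy` is therefore `v` tested against the Laplacian of a test function, which is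
zero: the means are independent of `p` as soon as the ball lies in `Ω` (`radialMean_eq_of_le`). By
Lebesgue differentiation they tend to `v(x)` for almost every `x`, so `v` agrees almost everywhere
with its own mollification, which is smooth, and harmonic by Green's identity
(`harmonicOnNhd_harmonicRep`).

The same means show that `v(x)` is the `L²(Ω)` inner product of `v` with `κ_p(· - x)`; projecting
this function to `𝓗(Ω)` gives the Bergman kernel `b_x` (`exists_inner_eq_bergmanRep`). The expansion
of `b(x, y)` is Parseval's identity for `(b_x, b_y)`, and the boundary formulas are
`v(x) = (b_x, A g) = (A* b_x, g)`. That a very weak solution is harmonic follows by testing with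
`u ∈ C_c^∞(Ω)`, whose normal derivative vanishes by Green's identity
(`IsVeryWeakDirichletSolution.hasWeakLaplacian_zero`).
-/

/-! ### The Laplacian: coordinates, Green's formula, radial functions -/

section Laplacian

variable {E : Type*} [NormedAddCommGroup E] [InnerProductSpace ℝ E] [FiniteDimensional ℝ E]

theorem laplacian_eq_sum_fderiv_fderiv {f : E → ℝ} (hf : ContDiff ℝ 2 f) (x : E) :
    (Δ f) x = ∑ i, fderiv ℝ (fun y => fderiv ℝ f y (stdOrthonormalBasis ℝ E i)) x
      (stdOrthonormalBasis ℝ E i) := by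
  rw [laplacian_eq_iteratedFDeriv_stdOrthonormalBasis]
  refine Finset.sum_congr rfl fun i _ => ?_
  have hd : DifferentiableAt ℝ (fderiv ℝ f) x :=
    (hf.fderiv_right (m := 1) (by norm_num)).differentiable (by norm_num) x
  rw [iteratedFDeriv_two_apply, fderiv_clm_apply hd (by fun_prop)]
  simp

theorem ContDiff.continuous_laplacian {f : E → ℝ} (hf : ContDiff ℝ 2 f) : Continuous (Δ f) := by
  have h2 : Continuous (iteratedFDeriv ℝ 2 f) := hf.continuous_iteratedFDeriv le_rfl
  rw [laplacian_eq_iteratedFDeriv_stdOrthonormalBasis f]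
  fun_prop

theorem support_laplacian_subset (f : E → ℝ) : Function.support (Δ f) ⊆ tsupport f := by
  intro x hx
  refine support_iteratedFDeriv_subset (𝕜 := ℝ) 2 fun h0 => hx ?_
  simp [laplacian_eq_iteratedFDeriv_stdOrthonormalBasis f, h0]

theorem inner_gradient_gradient {f g : E → ℝ} (x : E) :
    inner ℝ (∇ f x) (∇ g x) = ∑ i, fderiv ℝ f x (stdOrthonormalBasis ℝ E i) *
      fderiv ℝ g x (stdOrthonormalBasis ℝ E i) := by
  rw [← (stdOrthonormalBasis ℝ E).sum_inner_mul_inner]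
  simp

theorem support_gradient_subset (f : E → ℝ) : Function.support (∇ f) ⊆ tsupport f := by
  intro x hx
  refine support_fderiv_subset ℝ fun h0 => hx ?_
  simp [gradient, h0]

section Green

variable [MeasurableSpace E] [BorelSpace E]

theorem integral_mul_fderiv_of_hasCompactSupport {f g : E → ℝ} (hf : ContDiff ℝ 1 f)
    (hg : ContDiff ℝ 1 g) (hs : HasCompactSupport f ∨ HasCompactSupport g) (e : E) :
    ∫ x, f x * fderiv ℝ g x e = -∫ x, fderiv ℝ f x e * g x := by
  have hcf := hf.continuous_fderiv (by norm_num)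
  have hcg := hg.continuous_fderiv (by norm_num)
  have hf0 := hf.continuous
  have hg0 := hg.continuous
  refine integral_mul_fderiv_eq_neg_fderiv_mul_of_integrable ?_ ?_ ?_
    (fun x _ => hf.differentiable (by norm_num) x) fun x _ => hg.differentiable (by norm_num) x
  · refine Continuous.integrable_of_hasCompactSupport (by fun_prop) ?_
    rcases hs with hs | hs
    · exact (hs.fderiv_apply (𝕜 := ℝ) e).mul_right
    · exact hs.mul_left
  · refine Continuous.integrable_of_hasCompactSupport (by fun_prop) ?_
    rcases hs with hs | hs
    · exact hs.mul_right
    · exact (hs.fderiv_apply (𝕜 := ℝ) e).mul_left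
  · refine Continuous.integrable_of_hasCompactSupport (by fun_prop) ?_
    rcases hs with hs | hs
    · exact hs.mul_right
    · exact hs.mul_left

/-- Green's first identity on the whole space: there is no boundary term, since one of the
functions has compact support. -/
theorem integral_mul_laplacian_eq_neg_integral_inner_gradient {f g : E → ℝ} (hf : ContDiff ℝ 2 f)
    (hg : ContDiff ℝ 2 g) (hs : HasCompactSupport f ∨ HasCompactSupport g) :
    ∫ x, f x * (Δ g) x = -∫ x, inner ℝ (∇ f x) (∇ g x) := by
  have hcf := hf.continuous_fderiv (by norm_num)
  have hcg := hg.continuous_fderiv (by norm_num)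
  have hcgg : ∀ i, ContDiff ℝ 1 fun y => fderiv ℝ g y (stdOrthonormalBasis ℝ E i) := fun i =>
    (hg.fderiv_right (m := 1) (by norm_num)).clm_apply contDiff_const
  have hccg := fun i => (hcgg i).continuous_fderiv (by norm_num)
  have hf0 := hf.continuous
  simp_rw [laplacian_eq_sum_fderiv_fderiv hg, inner_gradient_gradient, Finset.mul_sum]
  rw [integral_finsetSum, integral_finsetSum, ← Finset.sum_neg_distrib]
  · refine Finset.sum_congr rfl fun i _ => ?_
    exact integral_mul_fderiv_of_hasCompactSupport (hf.of_le (by norm_num)) (hcgg i)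
      (hs.imp_right fun h => h.fderiv_apply (𝕜 := ℝ) _) _
  · intro i _
    refine Continuous.integrable_of_hasCompactSupport (by fun_prop) ?_
    rcases hs with hs | hs
    · exact (hs.fderiv_apply (𝕜 := ℝ) _).mul_right
    · exact (hs.fderiv_apply (𝕜 := ℝ) _).mul_left
  · intro i _
    refine Continuous.integrable_of_hasCompactSupport (by fun_prop) ?_
    rcases hs with hs | hs
    · exact hs.mul_right
    · exact ((hs.fderiv_apply (𝕜 := ℝ) _).fderiv_apply (𝕜 := ℝ) _).mul_left

theorem integral_laplacian_mul_eq_neg_integral_inner_gradient {f g : E → ℝ} (hf : ContDiff ℝ 2 f)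
    (hg : ContDiff ℝ 2 g) (hs : HasCompactSupport f ∨ HasCompactSupport g) :
    ∫ x, (Δ f) x * g x = -∫ x, inner ℝ (∇ f x) (∇ g x) := by
  simp_rw [mul_comm _ (g _), real_inner_comm (∇ g _)]
  exact integral_mul_laplacian_eq_neg_integral_inner_gradient hg hf hs.symm

theorem integral_mul_laplacian_comm {f g : E → ℝ} (hf : ContDiff ℝ 2 f) (hg : ContDiff ℝ 2 g)
    (hs : HasCompactSupport f ∨ HasCompactSupport g) :
    ∫ x, f x * (Δ g) x = ∫ x, (Δ f) x * g x := by
  rw [integral_mul_laplacian_eq_neg_integral_inner_gradient hf hg hs,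
    integral_laplacian_mul_eq_neg_integral_inner_gradient hf hg hs]

end Green

theorem laplacian_comp_norm_sub_sq {h h' h'' : ℝ → ℝ} (hh : ContDiff ℝ 2 h)
    (h1 : ∀ s, HasDerivAt h (h' s) s) (h2 : ∀ s, HasDerivAt h' (h'' s) s) (a x : E) :
    (Δ fun y => h (‖y - a‖ ^ 2)) x =
      2 * Module.finrank ℝ E * h' (‖x - a‖ ^ 2) + 4 * ‖x - a‖ ^ 2 * h'' (‖x - a‖ ^ 2) := by
  have hsq : ∀ y : E, HasFDerivAt (fun y : E => ‖y - a‖ ^ 2) (2 • innerSL ℝ (y - a)) y := by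
    intro y
    simpa using! ((hasFDerivAt_id y).sub_const a).norm_sq
  have hfd : ∀ y e : E, fderiv ℝ (fun y => h (‖y - a‖ ^ 2)) y e =
      h' (‖y - a‖ ^ 2) * (2 * inner ℝ (y - a) e) := by
    intro y e
    have := (h1 (‖y - a‖ ^ 2)).comp_hasFDerivAt y (hsq y)
    rw [show (fun y => h (‖y - a‖ ^ 2)) = h ∘ fun y : E => ‖y - a‖ ^ 2 from rfl, this.fderiv]
    simp [inner_sub_left]
  have hsum : ∑ i, inner ℝ (x - a) (stdOrthonormalBasis ℝ E i) ^ 2 = ‖x - a‖ ^ 2 := by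
    rw [← real_inner_self_eq_norm_sq, ← (stdOrthonormalBasis ℝ E).sum_inner_mul_inner]
    refine Finset.sum_congr rfl fun i _ => ?_
    rw [sq, real_inner_comm (x - a) (stdOrthonormalBasis ℝ E i)]
  have hsm : ContDiff ℝ 2 fun y : E => h (‖y - a‖ ^ 2) :=
    hh.comp ((contDiff_id.sub contDiff_const).norm_sq ℝ)
  rw [laplacian_eq_sum_fderiv_fderiv hsm]
  have hterm : ∀ i, fderiv ℝ (fun y => fderiv ℝ (fun y => h (‖y - a‖ ^ 2)) y
      (stdOrthonormalBasis ℝ E i)) x (stdOrthonormalBasis ℝ E i) = 2 * h' (‖x - a‖ ^ 2) +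
        4 * h'' (‖x - a‖ ^ 2) * inner ℝ (x - a) (stdOrthonormalBasis ℝ E i) ^ 2 := by
    intro i
    simp_rw [hfd]
    have e1 := (h2 (‖x - a‖ ^ 2)).comp_hasFDerivAt x (hsq x)
    have e2 : HasFDerivAt (fun y : E => 2 * inner ℝ (y - a) (stdOrthonormalBasis ℝ E i))
        ((2 : ℝ) • innerSL ℝ (stdOrthonormalBasis ℝ E i)) x := by
      have := ((innerSL ℝ (stdOrthonormalBasis ℝ E i)).hasFDerivAt.comp x
        ((hasFDerivAt_id x).sub_const a)).const_mul 2
      refine (this.congr_of_eventuallyEq (Eventually.of_forall fun y => ?_))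
      simp [real_inner_comm]
    have e3 : HasFDerivAt (fun y : E => h' (‖y - a‖ ^ 2) *
        (2 * inner ℝ (y - a) (stdOrthonormalBasis ℝ E i))) _ x := e1.mul e2
    rw [e3.fderiv]
    simp [inner_sub_left]
    ring
  rw [Finset.sum_congr rfl fun i _ => hterm i, Finset.sum_add_distrib, Finset.sum_const,
    ← Finset.mul_sum, hsum]
  simp
  ring

end Laplacian

/-! ### The radial kernels -/

section RadialKernel

/-- A smooth function of `s = ‖z‖²`, positive for `s < 1` and zero for `1 ≤ s`. -/
noncomputable def radialProfile (s : ℝ) : ℝ := Real.smoothTransition (1 - s)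

/-- The primitive of `radialProfile` that vanishes for `1 ≤ s`. -/
noncomputable def radialPrimitive (s : ℝ) : ℝ := ∫ t in (1 : ℝ)..s, radialProfile t

theorem contDiff_radialProfile : ContDiff ℝ ∞ radialProfile :=
  Real.smoothTransition.contDiff.comp (contDiff_const.sub contDiff_id)

theorem radialProfile_nonneg (s : ℝ) : 0 ≤ radialProfile s := Real.smoothTransition.nonneg _

theorem radialProfile_le_one (s : ℝ) : radialProfile s ≤ 1 := Real.smoothTransition.le_one _

theorem radialProfile_of_one_le {s : ℝ} (hs : 1 ≤ s) : radialProfile s = 0 :=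
  Real.smoothTransition.zero_of_nonpos (by linarith)

theorem hasDerivAt_radialProfile (s : ℝ) : HasDerivAt radialProfile (deriv radialProfile s) s :=
  (contDiff_radialProfile.differentiable (by simp) s).hasDerivAt

theorem continuous_deriv_radialProfile : Continuous (deriv radialProfile) :=
  contDiff_radialProfile.continuous_deriv (by simp)

theorem hasDerivAt_radialPrimitive (s : ℝ) :
    HasDerivAt radialPrimitive (radialProfile s) s :=
  intervalIntegral.integral_hasDerivAt_right
    (contDiff_radialProfile.continuous.intervalIntegrable _ _)
    contDiff_radialProfile.continuous.aestronglyMeasurable.stronglyMeasurableAtFilter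
    contDiff_radialProfile.continuous.continuousAt

theorem contDiff_radialPrimitive : ContDiff ℝ ∞ radialPrimitive := by
  refine contDiff_infty_iff_deriv.2
    ⟨fun s => (hasDerivAt_radialPrimitive s).differentiableAt, ?_⟩
  rw [funext fun s => (hasDerivAt_radialPrimitive s).deriv]
  exact contDiff_radialProfile

theorem radialPrimitive_of_one_le {s : ℝ} (hs : 1 ≤ s) : radialPrimitive s = 0 := by
  refine (intervalIntegral.integral_congr fun t ht => ?_).trans intervalIntegral.integral_zero
  rw [Set.uIcc_of_le hs] at ht
  exact radialProfile_of_one_le ht.1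

variable {E : Type*} [NormedAddCommGroup E]

theorem one_le_sq_mul_norm_sub_sq_of_notMem_closedBall {p : ℝ} (hp : 0 < p) {z a : E}
    (hz : z ∉ Metric.closedBall a p⁻¹) : 1 ≤ p ^ 2 * ‖z - a‖ ^ 2 := by
  rw [Metric.mem_closedBall, dist_eq_norm, not_le] at hz
  rw [← mul_pow]
  refine one_le_pow₀ ?_
  calc (1 : ℝ) = p * p⁻¹ := (mul_inv_cancel₀ hp.ne').symm
    _ ≤ p * ‖z - a‖ := by gcongr

theorem support_comp_norm_sub_sq_subset {h : ℝ → ℝ} (hh : ∀ s, 1 ≤ s → h s = 0) {p : ℝ}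
    (hp : 0 < p) (a : E) :
    (Function.support fun z => h (p ^ 2 * ‖z - a‖ ^ 2)) ⊆ Metric.closedBall a p⁻¹ := by
  intro z hz
  by_contra hz'
  exact hz (hh _ (one_le_sq_mul_norm_sub_sq_of_notMem_closedBall hp hz'))

variable [InnerProductSpace ℝ E] [FiniteDimensional ℝ E] [MeasurableSpace E] [BorelSpace E]

variable (E) in
/-- The normalizing constant of the radial kernels. -/
noncomputable def radialMass : ℝ := ∫ z : E, radialProfile (‖z‖ ^ 2)

variable (E) in
theorem radialMass_pos : 0 < radialMass E := by
  refine Continuous.integral_pos_of_hasCompactSupport_nonneg_nonzero (x := 0)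
    (contDiff_radialProfile.continuous.comp (by fun_prop)) ?_
    (fun z => radialProfile_nonneg _) ?_
  · refine HasCompactSupport.of_support_subset_isCompact (isCompact_closedBall (0 : E) 1⁻¹) ?_
    simpa using support_comp_norm_sub_sq_subset (h := radialProfile)
      (fun s hs => radialProfile_of_one_le hs) one_pos (0 : E)
  · exact (Real.smoothTransition.pos_of_pos (by simp)).ne'

/-- The smooth radial probability density of radius `1 / p`, with mass one. The scale is `1 / p`
rather than `p`, so that the kernel is smooth in `p` as well. -/
noncomputable def radialKernel (p : ℝ) (z : E) : ℝ :=
  (radialMass E)⁻¹ * (p ^ Module.finrank ℝ E * radialProfile (p ^ 2 * ‖z‖ ^ 2))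

/-- The derivative of `radialKernel p z` in `p`. -/
noncomputable def radialKernelDeriv (p : ℝ) (z : E) : ℝ :=
  (radialMass E)⁻¹ *
    (Module.finrank ℝ E * p ^ (Module.finrank ℝ E - 1) * radialProfile (p ^ 2 * ‖z‖ ^ 2) +
      p ^ Module.finrank ℝ E * (deriv radialProfile (p ^ 2 * ‖z‖ ^ 2) * (2 * p * ‖z‖ ^ 2)))

theorem hasDerivAt_radialKernel (p : ℝ) (z : E) :
    HasDerivAt (fun p => radialKernel p z) (radialKernelDeriv p z) p := by
  have h1 : HasDerivAt (fun p : ℝ => p ^ 2 * ‖z‖ ^ 2) (2 * p * ‖z‖ ^ 2) p := by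
    simpa using (hasDerivAt_pow 2 p).mul_const (‖z‖ ^ 2)
  exact ((hasDerivAt_pow (Module.finrank ℝ E) p).mul
    ((hasDerivAt_radialProfile _).comp p h1)).const_mul (radialMass E)⁻¹

theorem continuous_radialKernelDeriv :
    Continuous fun q : ℝ × E => radialKernelDeriv q.1 q.2 := by
  have h1 := contDiff_radialProfile.continuous
  have h2 := continuous_deriv_radialProfile
  unfold radialKernelDeriv
  fun_prop

theorem contDiff_radialKernel (p : ℝ) : ContDiff ℝ ∞ (radialKernel p : E → ℝ) :=
  contDiff_const.mul (contDiff_const.mul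
    (contDiff_radialProfile.comp (contDiff_const.mul (contDiff_id.norm_sq ℝ))))

theorem radialKernel_nonneg {p : ℝ} (hp : 0 ≤ p) (z : E) : 0 ≤ radialKernel p z :=
  mul_nonneg (inv_nonneg.2 (radialMass_pos E).le)
    (mul_nonneg (pow_nonneg hp _) (radialProfile_nonneg _))

theorem radialKernel_le {p : ℝ} (hp : 0 ≤ p) (z : E) :
    radialKernel p z ≤ (radialMass E)⁻¹ * p ^ Module.finrank ℝ E := by
  have := (radialMass_pos E).le
  exact mul_le_mul_of_nonneg_left
    (mul_le_of_le_one_right (pow_nonneg hp _) (radialProfile_le_one _)) (by positivity)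

theorem radialKernel_neg (p : ℝ) (z : E) : radialKernel p (-z) = radialKernel p z := by
  simp [radialKernel]

theorem support_radialKernel_sub_subset {p : ℝ} (hp : 0 < p) (a : E) :
    (Function.support fun z => radialKernel p (z - a)) ⊆ Metric.closedBall a p⁻¹ := by
  refine fun z hz => support_comp_norm_sub_sq_subset (h := radialProfile)
    (fun s hs => radialProfile_of_one_le hs) hp a fun h0 => hz ?_
  simp_all [radialKernel]

theorem hasCompactSupport_radialKernel_sub {p : ℝ} (hp : 0 < p) (a : E) :
    HasCompactSupport fun z => radialKernel p (z - a) :=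
  HasCompactSupport.of_support_subset_isCompact (isCompact_closedBall a p⁻¹)
    (support_radialKernel_sub_subset hp a)

theorem integral_radialKernel_sub {p : ℝ} (hp : 0 < p) (a : E) :
    ∫ z, radialKernel p (z - a) = 1 := by
  rw [integral_sub_right_eq_self (fun z => radialKernel p z)]
  have h : ∀ z : E, radialProfile (p ^ 2 * ‖z‖ ^ 2) = radialProfile (‖p • z‖ ^ 2) := by
    intro z
    rw [norm_smul, mul_pow, Real.norm_eq_abs, sq_abs]
  unfold radialKernel
  simp_rw [h]
  rw [integral_const_mul, integral_const_mul,
    Measure.integral_comp_smul_of_nonneg volume (fun z : E => radialProfile (‖z‖ ^ 2)) p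
      (hR := hp.le), smul_eq_mul, mul_inv_cancel_left₀ (pow_pos hp _).ne']
  exact inv_mul_cancel₀ (radialMass_pos E).ne'

/-- The compactly supported radial function whose Laplacian is the derivative of the kernel in
`p`. -/
noncomputable def radialPotential (p : ℝ) (a y : E) : ℝ :=
  (radialMass E)⁻¹ * p ^ Module.finrank ℝ E / (2 * p ^ 3) *
    radialPrimitive (p ^ 2 * ‖y - a‖ ^ 2)

theorem contDiff_radialPotential (p : ℝ) (a : E) : ContDiff ℝ ∞ (radialPotential p a) :=
  contDiff_const.mul (contDiff_radialPrimitive.comp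
    (contDiff_const.mul ((contDiff_id.sub contDiff_const).norm_sq ℝ)))

theorem tsupport_radialPotential_subset {p : ℝ} (hp : 0 < p) (a : E) :
    tsupport (radialPotential p a) ⊆ Metric.closedBall a p⁻¹ := by
  refine closure_minimal (fun z hz => ?_) Metric.isClosed_closedBall
  refine support_comp_norm_sub_sq_subset (h := radialPrimitive)
    (fun s hs => radialPrimitive_of_one_le hs) hp a fun h0 => hz ?_
  simp_all [radialPotential]

/-- Changing the scale of the radial kernel adds the Laplacian of a compactly supported function,
since `n f(‖z‖²) + z · ∇(f(‖z‖²)) = div (f(‖z‖²) z)` and `f(‖z‖²) z` is the gradient of half the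
primitive of `f` at `‖z‖²`. -/
theorem laplacian_radialPotential {p : ℝ} (hp : 0 < p) (a y : E) :
    (Δ (radialPotential p a)) y = radialKernelDeriv p (y - a) := by
  set c : ℝ := (radialMass E)⁻¹ * p ^ Module.finrank ℝ E / (2 * p ^ 3) with hc
  have hs : ∀ s, HasDerivAt (fun s : ℝ => p ^ 2 * s) (p ^ 2) s := fun s => by
    simpa using (hasDerivAt_id s).const_mul (p ^ 2)
  have key := laplacian_comp_norm_sub_sq (h := fun s => c * radialPrimitive (p ^ 2 * s))
    (h' := fun s => c * (radialProfile (p ^ 2 * s) * p ^ 2))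
    (h'' := fun s => c * (deriv radialProfile (p ^ 2 * s) * p ^ 2 * p ^ 2))
    (contDiff_infty.1 (contDiff_const.mul (contDiff_radialPrimitive.comp
      (contDiff_const.mul contDiff_id))) 2)
    (fun s => ((hasDerivAt_radialPrimitive _).comp s (hs s)).const_mul c)
    (fun s => (((hasDerivAt_radialProfile _).comp s (hs s)).mul_const _).const_mul c) a y
  refine key.trans ?_
  have hpow : (Module.finrank ℝ E : ℝ) * p ^ (Module.finrank ℝ E - 1) =
      Module.finrank ℝ E * (p ^ Module.finrank ℝ E / p) := by
    rcases Module.finrank ℝ E with - | n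
    · simp
    · rw [Nat.add_sub_cancel, pow_succ, mul_div_cancel_right₀ _ hp.ne']
  rw [radialKernelDeriv, hpow, hc]
  field_simp
  ring

end RadialKernel

/-! ### Weyl's lemma -/

section Weyl

variable {d : ℕ} {Ω : Set (EuclideanSpace ℝ (Fin d))} {v : EuclideanSpace ℝ (Fin d) → ℝ}

theorem setIntegral_mul_laplacian_eq_zero (hw : HasWeakLaplacian Ω v 0)
    {φ : EuclideanSpace ℝ (Fin d) → ℝ} (hφ : IsTestFunction Ω φ) :
    ∫ x in Ω, v x * (Δ φ) x = 0 := by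
  simpa using hw φ hφ

/-- The mean of `v` over `Ω` around `x` at scale `1 / p`. -/
noncomputable def radialMean (Ω : Set (EuclideanSpace ℝ (Fin d)))
    (v : EuclideanSpace ℝ (Fin d) → ℝ) (p : ℝ) (x : EuclideanSpace ℝ (Fin d)) : ℝ :=
  ∫ y in Ω, v y * radialKernel p (y - x)

theorem hasDerivAt_radialMean (hb : Bornology.IsBounded Ω) (hv : IntegrableOn v Ω)
    (x : EuclideanSpace ℝ (Fin d)) (p : ℝ) :
    HasDerivAt (fun p => radialMean Ω v p x) (∫ y in Ω, v y * radialKernelDeriv p (y - x)) p := by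
  have hcont : Continuous fun q : ℝ × EuclideanSpace ℝ (Fin d) =>
      radialKernelDeriv q.1 (q.2 - x) :=
    continuous_radialKernelDeriv.comp (by fun_prop : Continuous fun q :
      ℝ × EuclideanSpace ℝ (Fin d) => (q.1, q.2 - x))
  obtain ⟨C, hC⟩ := ((isCompact_closedBall p 1).prod
    hb.isCompact_closure).exists_bound_of_continuousOn hcont.continuousOn
  obtain ⟨C', hC'⟩ := hb.isCompact_closure.exists_bound_of_continuousOn
    ((contDiff_radialKernel p).continuous.comp (continuous_sub_right x)).continuousOn
  have hmem : ∀ᵐ y ∂(volume.restrict Ω), y ∈ closure Ω :=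
    ae_mono (Measure.restrict_mono subset_closure le_rfl)
      (ae_restrict_mem isClosed_closure.measurableSet)
  have hmeas : ∀ q : ℝ, AEStronglyMeasurable (fun y => v y * radialKernel q (y - x))
      (volume.restrict Ω) := fun q => hv.aestronglyMeasurable.mul
    ((contDiff_radialKernel q).continuous.comp (continuous_sub_right x)).aestronglyMeasurable
  refine (hasDerivAt_integral_of_dominated_loc_of_deriv_le
    (F' := fun q y => v y * radialKernelDeriv q (y - x))
    (bound := fun y => ‖v y‖ * C)
    (Metric.closedBall_mem_nhds p one_pos) (Eventually.of_forall hmeas) ?_ ?_ ?_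
    (hv.norm.mul_const C) ?_).2
  · refine (hv.norm.mul_const C').mono' (hmeas p) ?_
    filter_upwards [hmem] with y hy
    rw [norm_mul]
    exact mul_le_mul_of_nonneg_left (hC' y hy) (norm_nonneg _)
  · exact hv.aestronglyMeasurable.mul
      (hcont.comp (Continuous.prodMk_right p)).aestronglyMeasurable
  · filter_upwards [hmem] with y hy q hq
    rw [norm_mul]
    exact mul_le_mul_of_nonneg_left (hC (q, y) ⟨hq, hy⟩) (norm_nonneg _)
  · exact Eventually.of_forall fun y q _ => (hasDerivAt_radialKernel q (y - x)).const_mul (v y)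

/-- The mean value property in weak form: the means of a weakly harmonic function over balls inside
`Ω` do not depend on the radius. -/
theorem radialMean_eq_of_le (hb : Bornology.IsBounded Ω) (hv : IntegrableOn v Ω)
    (hw : HasWeakLaplacian Ω v 0) {x : EuclideanSpace ℝ (Fin d)} {p q : ℝ} (hp : 0 < p)
    (hx : Metric.closedBall x p⁻¹ ⊆ Ω) (hpq : p ≤ q) :
    radialMean Ω v q x = radialMean Ω v p x := by
  have hd : ∀ t ∈ Set.Icc p q, HasDerivAt (fun p => radialMean Ω v p x) 0 t := by
    intro t ht
    have ht0 : 0 < t := hp.trans_le ht.1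
    have hφ : IsTestFunction Ω (radialPotential t x) := by
      have hsub := tsupport_radialPotential_subset ht0 x
      exact ⟨contDiff_radialPotential t x,
        (isCompact_closedBall x t⁻¹).of_isClosed_subset (isClosed_tsupport _) hsub,
        hsub.trans ((Metric.closedBall_subset_closedBall (inv_anti₀ hp ht.1)).trans hx)⟩
    have h := hasDerivAt_radialMean hb hv x t
    simp_rw [← laplacian_radialPotential ht0 x] at h
    rwa [setIntegral_mul_laplacian_eq_zero hw hφ] at h
  exact constant_of_has_deriv_right_zero
    (fun t ht => (hd t ht).continuousAt.continuousWithinAt)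
    (fun t ht => (hd t (Set.Ico_subset_Icc_self ht)).hasDerivWithinAt) q ⟨hpq, le_rfl⟩

theorem radialMean_eq_integral_indicator (ho : MeasurableSet Ω) (p : ℝ)
    (x : EuclideanSpace ℝ (Fin d)) :
    radialMean Ω v p x = ∫ y, radialKernel p (y - x) • Ω.indicator v y := by
  rw [radialMean, ← integral_indicator ho]
  refine integral_congr_ae (Eventually.of_forall fun y => ?_)
  by_cases hy : y ∈ Ω <;> simp [hy, mul_comm]

theorem ae_tendsto_radialMean (ho : MeasurableSet Ω) (hv : IntegrableOn v Ω) :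
    ∀ᵐ x ∂(volume.restrict Ω), Tendsto (fun p => radialMean Ω v p x) atTop (𝓝 (v x)) := by
  have hu : LocallyIntegrable (Ω.indicator v) volume :=
    ((integrable_indicator_iff ho).2 hv).locallyIntegrable
  filter_upwards [ae_restrict_of_ae ((Besicovitch.vitaliFamily volume).ae_tendsto_average_norm_sub
    hu), ae_restrict_mem ho] with x hx hxΩ
  simp_rw [radialMean_eq_integral_indicator ho]
  rw [← Set.indicator_of_mem hxΩ v]
  have hlim : Tendsto (fun p : ℝ => p⁻¹) atTop (𝓝[>] 0) := tendsto_inv_atTop_nhdsGT_zero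
  -- The constant is the maximum of the kernel times the volume of its ball, at any scale.
  refine tendsto_integral_smul_of_tendsto_average_norm_sub
    ((radialMass (EuclideanSpace ℝ (Fin d)))⁻¹ *
      volume.real (Metric.ball (0 : EuclideanSpace ℝ (Fin d)) 1))
    ((hx.comp (Besicovitch.tendsto_filterAt volume x)).comp hlim) ?_ ?_ ?_ ?_
  · exact Eventually.of_forall fun p => hu.integrableOn_isCompact (isCompact_closedBall _ _)
  · refine tendsto_const_nhds.congr' ?_
    filter_upwards [eventually_gt_atTop 0] with p hp
    exact (integral_radialKernel_sub hp x).symm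
  · filter_upwards [eventually_gt_atTop 0] with p hp
    exact support_radialKernel_sub_subset hp x
  · filter_upwards [eventually_gt_atTop 0] with p hp y
    have hB : 0 < volume.real (Metric.ball (0 : EuclideanSpace ℝ (Fin d)) 1) :=
      ENNReal.toReal_pos (Metric.measure_ball_pos _ _ one_pos).ne' measure_ball_lt_top.ne
    rw [abs_of_nonneg (radialKernel_nonneg hp.le _),
      Measure.addHaar_real_closedBall _ _ (inv_pos.2 hp).le]
    refine (radialKernel_le hp.le _).trans_eq ?_
    rw [inv_pow]
    field_simp

theorem radialMean_eq_convolution (ho : MeasurableSet Ω) (p : ℝ) :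
    radialMean Ω v p = MeasureTheory.convolution (radialKernel p) (Ω.indicator v)
      (ContinuousLinearMap.lsmul ℝ ℝ) volume := by
  ext x
  rw [convolution_lsmul_swap, radialMean_eq_integral_indicator ho]
  refine integral_congr_ae (Eventually.of_forall fun y => ?_)
  change _ = radialKernel p (x - y) • Ω.indicator v y
  rw [← radialKernel_neg, neg_sub]

theorem contDiff_radialMean (ho : MeasurableSet Ω) (hv : IntegrableOn v Ω) {p : ℝ} (hp : 0 < p) :
    ContDiff ℝ ∞ (radialMean Ω v p) := by
  rw [radialMean_eq_convolution ho]
  refine HasCompactSupport.contDiff_convolution_left _ ?_ (contDiff_radialKernel p)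
    ((integrable_indicator_iff ho).2 hv).locallyIntegrable
  simpa using hasCompactSupport_radialKernel_sub hp (0 : EuclideanSpace ℝ (Fin d))

/-- The value at `x` of the harmonic function represented by `v`: the limit of the means of `v`
around `x`. -/
noncomputable def harmonicRep (Ω : Set (EuclideanSpace ℝ (Fin d)))
    (v : EuclideanSpace ℝ (Fin d) → ℝ) (x : EuclideanSpace ℝ (Fin d)) : ℝ :=
  limUnder atTop fun p => radialMean Ω v p x

theorem harmonicRep_eq_radialMean (hb : Bornology.IsBounded Ω) (hv : IntegrableOn v Ω)
    (hw : HasWeakLaplacian Ω v 0) {x : EuclideanSpace ℝ (Fin d)} {p : ℝ} (hp : 0 < p)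
    (hx : Metric.closedBall x p⁻¹ ⊆ Ω) : harmonicRep Ω v x = radialMean Ω v p x := by
  refine Tendsto.limUnder_eq (tendsto_const_nhds.congr' ?_)
  filter_upwards [eventually_ge_atTop p] with q hq
  exact (radialMean_eq_of_le hb hv hw hp hx hq).symm

theorem ae_eq_harmonicRep (ho : MeasurableSet Ω) (hv : IntegrableOn v Ω) :
    v =ᵐ[volume.restrict Ω] harmonicRep Ω v := by
  filter_upwards [ae_tendsto_radialMean ho hv] with x hx
  exact hx.limUnder_eq.symm

theorem exists_pos_closedBall_inv_subset (ho : IsOpen Ω) {x : EuclideanSpace ℝ (Fin d)}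
    (hx : x ∈ Ω) : ∃ p : ℝ, 0 < p ∧ Metric.closedBall x p⁻¹ ⊆ Ω := by
  obtain ⟨r, hr, hrΩ⟩ := Metric.nhds_basis_closedBall.mem_iff.1 (ho.mem_nhds hx)
  exact ⟨r⁻¹, inv_pos.2 hr, by rwa [inv_inv]⟩

/-- **Weyl's lemma**: a weakly harmonic function is represented by a harmonic function. -/
theorem harmonicOnNhd_harmonicRep (ho : IsOpen Ω) (hb : Bornology.IsBounded Ω)
    (hv : IntegrableOn v Ω) (hw : HasWeakLaplacian Ω v 0) :
    HarmonicOnNhd (harmonicRep Ω v) Ω := by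
  intro x hx
  obtain ⟨r, hr, hrΩ⟩ := Metric.nhds_basis_closedBall.mem_iff.1 (ho.mem_nhds hx)
  -- At the scale `r / 2`, one kernel serves all points of the ball of radius `r / 2` around `x`.
  have hp : 0 < (r / 2)⁻¹ := by positivity
  have hsub : ∀ y ∈ Metric.ball x (r / 2), Metric.closedBall y (r / 2)⁻¹⁻¹ ⊆ Ω := by
    intro y hy
    rw [inv_inv]
    refine (Metric.closedBall_subset_closedBall' ?_).trans hrΩ
    linarith [Metric.mem_ball.1 hy]
  have hBΩ : Metric.ball x (r / 2) ⊆ Ω := fun y hy =>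
    hsub y hy (Metric.mem_closedBall_self (by positivity))
  set w := radialMean Ω v (r / 2)⁻¹ with hwdef
  have hrep : Set.EqOn (harmonicRep Ω v) w (Metric.ball x (r / 2)) := fun y hy =>
    harmonicRep_eq_radialMean hb hv hw hp (hsub y hy)
  have hsm : ContDiff ℝ ∞ w := contDiff_radialMean ho.measurableSet hv hp
  have hsm2 : ContDiff ℝ 2 w := contDiff_infty.1 hsm 2
  have hzero : ∀ᵐ y, y ∈ Metric.ball x (r / 2) → (Δ w) y = 0 := by
    refine Metric.isOpen_ball.ae_eq_zero_of_integral_contDiff_smul_eq_zero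
      (hsm2.continuous_laplacian.locallyIntegrable.locallyIntegrableOn _) fun φ hφ hφc hφB => ?_
    calc ∫ y, φ y • (Δ w) y = ∫ y, (Δ φ) y * w y :=
          integral_mul_laplacian_comm (contDiff_infty.1 hφ 2) hsm2 (Or.inl hφc)
      _ = ∫ y in Ω, (Δ φ) y * w y := by
          refine (setIntegral_eq_integral_of_forall_compl_eq_zero fun y hy => ?_).symm
          rw [Function.notMem_support.1 fun h =>
            hy (hBΩ (hφB (support_laplacian_subset φ h))), zero_mul]
      _ = ∫ y in Ω, v y * (Δ φ) y := by
          refine integral_congr_ae ?_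
          filter_upwards [ae_eq_harmonicRep ho.measurableSet hv] with y hy
          by_cases hyφ : y ∈ tsupport φ
          · rw [hy, hrep (hφB hyφ), mul_comm]
          · rw [Function.notMem_support.1 fun h => hyφ (support_laplacian_subset φ h), zero_mul,
              mul_zero]
      _ = 0 := setIntegral_mul_laplacian_eq_zero hw ⟨hφ, hφc, hφB.trans hBΩ⟩
  have hzero' : Set.EqOn (Δ w) 0 (Metric.ball x (r / 2)) :=
    Measure.eqOn_open_of_ae_eq ((ae_restrict_iff' measurableSet_ball).2 hzero) Metric.isOpen_ball
      hsm2.continuous_laplacian.continuousOn continuousOn_const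
  have hball : Metric.ball x (r / 2) ∈ 𝓝 x := Metric.ball_mem_nhds x (by positivity)
  exact (harmonicAt_congr_nhds (hrep.eventuallyEq_of_mem hball)).2
    ⟨hsm2.contDiffAt, hzero'.eventuallyEq_of_mem hball⟩

end Weyl

/-! ### The Bergman kernel -/

section Bergman

variable {d : ℕ} {Ω : Set (EuclideanSpace ℝ (Fin d))}

theorem integrableOn_L2Domain (hb : Bornology.IsBounded Ω) (v : L2Domain Ω) :
    IntegrableOn v Ω := by
  have : IsFiniteMeasure (volume.restrict Ω) := ⟨by simpa using hb.measure_lt_top⟩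
  exact (Lp.memLp v).integrable (by norm_num)

theorem bergmanRep_spec (ho : IsOpen Ω) (hb : Bornology.IsBounded Ω) (v : bergmanSpace Ω) :
    HarmonicOnNhd (bergmanRep Ω v) Ω ∧
      ((v : L2Domain Ω) : EuclideanSpace ℝ (Fin d) → ℝ) =ᵐ[volume.restrict Ω] bergmanRep Ω v := by
  have h : ∃ f : EuclideanSpace ℝ (Fin d) → ℝ, HarmonicOnNhd f Ω ∧
      ((v : L2Domain Ω) : EuclideanSpace ℝ (Fin d) → ℝ) =ᵐ[volume.restrict Ω] f :=
    ⟨harmonicRep Ω (v : L2Domain Ω),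
      harmonicOnNhd_harmonicRep ho hb (integrableOn_L2Domain hb _) v.2,
      ae_eq_harmonicRep ho.measurableSet (integrableOn_L2Domain hb _)⟩
  rw [bergmanRep, dif_pos h]
  exact h.choose_spec

theorem bergmanRep_eq_harmonicRep (ho : IsOpen Ω) (hb : Bornology.IsBounded Ω)
    (v : bergmanSpace Ω) : Set.EqOn (bergmanRep Ω v) (harmonicRep Ω (v : L2Domain Ω)) Ω := by
  obtain ⟨hh, hae⟩ := bergmanRep_spec ho hb v
  have hv := integrableOn_L2Domain hb (v : L2Domain Ω)
  exact Measure.eqOn_open_of_ae_eq (hae.symm.trans (ae_eq_harmonicRep ho.measurableSet hv)) ho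
    hh.continuousOn (harmonicOnNhd_harmonicRep ho hb hv v.2).continuousOn

/-- Point evaluation is the inner product with a radial kernel, hence bounded; the Bergman kernel is
the orthogonal projection of that radial kernel to `𝓗(Ω)`. -/
theorem exists_inner_eq_bergmanRep (ho : IsOpen Ω) (hb : Bornology.IsBounded Ω)
    {x : EuclideanSpace ℝ (Fin d)} (hx : x ∈ Ω) :
    ∃ k : bergmanSpace Ω, ∀ v : bergmanSpace Ω, inner ℝ k v = bergmanRep Ω v x := by
  obtain ⟨p, hp, hpΩ⟩ := exists_pos_closedBall_inv_subset ho hx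
  have hκ : MemLp (fun y => radialKernel p (y - x)) 2 (volume.restrict Ω) :=
    ((contDiff_radialKernel p).continuous.comp
      (continuous_sub_right x)).memLp_of_hasCompactSupport (hasCompactSupport_radialKernel_sub hp x)
  refine ⟨(bergmanSpace Ω).orthogonalProjectionOnto (hκ.toLp _), fun v => ?_⟩
  rw [Submodule.inner_orthogonalProjectionOnto_eq_of_mem_right, bergmanRep_eq_harmonicRep ho hb v hx,
    harmonicRep_eq_radialMean hb (integrableOn_L2Domain hb _) v.2 hp hpΩ, L2.inner_def, radialMean]
  refine integral_congr_ae ?_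
  filter_upwards [hκ.coeFn_toLp] with y hy
  simp [hy]

theorem inner_bergmanKernel (ho : IsOpen Ω) (hb : Bornology.IsBounded Ω)
    {x : EuclideanSpace ℝ (Fin d)} (hx : x ∈ Ω) (v : bergmanSpace Ω) :
    inner ℝ (bergmanKernel Ω x) v = bergmanRep Ω v x := by
  have h := exists_inner_eq_bergmanRep ho hb hx
  rw [bergmanKernel, dif_pos h]
  exact h.choose_spec v

theorem bergmanRep_eq_integral (ho : IsOpen Ω) (hb : Bornology.IsBounded Ω)
    {x : EuclideanSpace ℝ (Fin d)} (hx : x ∈ Ω) (v : bergmanSpace Ω) :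
    IntegrableOn (fun y => bergmanRep Ω (bergmanKernel Ω x) y * bergmanRep Ω v y) Ω ∧
      bergmanRep Ω v x = ∫ y in Ω, bergmanRep Ω (bergmanKernel Ω x) y * bergmanRep Ω v y := by
  have hae : (fun y => inner ℝ ((bergmanKernel Ω x : L2Domain Ω) y) ((v : L2Domain Ω) y))
      =ᵐ[volume.restrict Ω] fun y => bergmanRep Ω (bergmanKernel Ω x) y * bergmanRep Ω v y := by
    filter_upwards [(bergmanRep_spec ho hb v).2,
      (bergmanRep_spec ho hb (bergmanKernel Ω x)).2] with y h1 h2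
    simp [h1, h2, mul_comm]
  refine ⟨(L2.integrable_inner (𝕜 := ℝ) _ _).congr hae, ?_⟩
  rw [← inner_bergmanKernel ho hb hx v, Submodule.coe_inner, L2.inner_def]
  exact integral_congr_ae hae

theorem hasSum_bergmanRep_mul (ho : IsOpen Ω) (hb : Bornology.IsBounded Ω) {ι : Type*}
    (φ : HilbertBasis ι ℝ (bergmanSpace Ω)) {x y : EuclideanSpace ℝ (Fin d)} (hx : x ∈ Ω)
    (hy : y ∈ Ω) :
    HasSum (fun n => bergmanRep Ω (φ n) x * bergmanRep Ω (φ n) y)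
      (bergmanRep Ω (bergmanKernel Ω x) y) := by
  have h := φ.hasSum_inner_mul_inner (bergmanKernel Ω x) (bergmanKernel Ω y)
  rw [real_inner_comm (bergmanKernel Ω y), inner_bergmanKernel ho hb hy] at h
  simpa only [real_inner_comm (bergmanKernel Ω y), inner_bergmanKernel ho hb hx,
    inner_bergmanKernel ho hb hy] using h

/-! ### Boundary integral formulas -/

theorem integrable_and_inner_eq_integral_mul (f g : L2Boundary Ω) :
    Integrable (fun y => f y * g y) (surfaceMeasure Ω) ∧
      inner ℝ f g = ∫ y, f y * g y ∂(surfaceMeasure Ω) := by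
  have h : (fun y => inner ℝ (f y) (g y)) = fun y => f y * g y := by
    ext y
    simp [mul_comm]
  exact ⟨h ▸ L2.integrable_inner (𝕜 := ℝ) f g, by rw [L2.inner_def, h]⟩

/-- A test function on `Ω` is admissible in the very weak formulation, with zero normal
derivative. -/
theorem IsVeryWeakDirichletSolution.hasWeakLaplacian_zero {g : L2Boundary Ω} {v : L2Domain Ω}
    (h : IsVeryWeakDirichletSolution Ω g v) : HasWeakLaplacian Ω v 0 := by
  intro φ hφ
  have hφ2 : ContDiff ℝ 2 φ := contDiff_infty.1 hφ.contDiff 2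
  have hgrad : MemLp (∇ φ) 2 (volume.restrict Ω) := by
    have hc : Continuous (∇ φ) := (toDual ℝ (EuclideanSpace ℝ (Fin d))).symm.continuous.comp
      (hφ2.continuous_fderiv (by norm_num))
    exact hc.memLp_of_hasCompactSupport (HasCompactSupport.of_support_subset_isCompact
      hφ.hasCompactSupport (support_gradient_subset φ))
  have hout : ∀ x, x ∉ Ω → x ∉ tsupport φ := fun x hx hx' => hx (hφ.tsupport_subset hx')
  have hlap : ∀ x, x ∉ Ω → (Δ φ) x = 0 := fun x hx =>
    Function.notMem_support.1 fun h => hout x hx (support_laplacian_subset φ h)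
  have hH10 : MemH10 Ω φ (∇ φ) :=
    ⟨hφ.contDiff.continuous.memLp_of_hasCompactSupport hφ.hasCompactSupport, hgrad,
      fun _ => φ, fun _ => hφ, by simp, by simp⟩
  have hweak : HasWeakLaplacian Ω φ (Δ φ) := by
    intro ψ hψ
    rw [setIntegral_eq_integral_of_forall_compl_eq_zero fun x hx => by
        rw [image_eq_zero_of_notMem_tsupport (hout x hx), zero_mul],
      setIntegral_eq_integral_of_forall_compl_eq_zero fun x hx => by rw [hlap x hx, zero_mul]]
    exact integral_mul_laplacian_comm hφ2 (contDiff_infty.1 hψ.contDiff 2)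
      (Or.inl hφ.hasCompactSupport)
  have hnormal : HasNormalDerivative Ω (∇ φ) (Δ φ) 0 := by
    intro w hw
    have h0 : ∫ y, (0 : L2Boundary Ω) y * w y ∂(surfaceMeasure Ω) = 0 := by
      refine integral_eq_zero_of_ae ?_
      filter_upwards [Lp.coeFn_zero ℝ 2 (surfaceMeasure Ω)] with y hy
      rw [hy, Pi.zero_apply, zero_mul]
    rw [h0, add_zero, setIntegral_eq_integral_of_forall_compl_eq_zero fun x hx => by
        rw [Function.notMem_support.1 fun h => hout x hx (support_gradient_subset φ h),
          inner_zero_left],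
      setIntegral_eq_integral_of_forall_compl_eq_zero fun x hx => by rw [hlap x hx, zero_mul],
      integral_laplacian_mul_eq_neg_integral_inner_gradient hφ2 (contDiff_infty.1 hw.contDiff 2)
        (Or.inl hφ.hasCompactSupport), neg_neg]
  have hg0 : ∫ y, g y * (0 : L2Boundary Ω) y ∂(surfaceMeasure Ω) = 0 :=
    (integrable_and_inner_eq_integral_mul g 0).2.symm.trans (inner_zero_right g)
  rw [h φ (∇ φ) (Δ φ) 0 hH10 (hφ.memLp_laplacian _) hweak hnormal, hg0]
  simp

end Bergman

theorem proposition9p1 {d : ℕ} (hd : 1 ≤ d) (Ω : Set (EuclideanSpace ℝ (Fin d)))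
    (hΩ : IsBoundedLipschitzDomain Ω) :
    -- every element of `𝓗(Ω)` is (represented by) a harmonic function on `Ω`
    (∀ v : bergmanSpace Ω, InnerProductSpace.HarmonicOnNhd (bergmanRep Ω v) Ω ∧
      ((v : L2Domain Ω) : EuclideanSpace ℝ (Fin d) → ℝ) =ᵐ[volume.restrict Ω] bergmanRep Ω v) ∧
    -- the Bergman kernel `b(x, y) = b_x(y)` reproduces `𝓗(Ω)`
    (∀ x ∈ Ω, ∀ v : bergmanSpace Ω,
      IntegrableOn (fun y => bergmanRep Ω (bergmanKernel Ω x) y * bergmanRep Ω v y) Ω ∧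
      bergmanRep Ω v x =
        ∫ y in Ω, bergmanRep Ω (bergmanKernel Ω x) y * bergmanRep Ω v y) ∧
    -- it is the sum `b(x, y) = ∑ φ_n(x) φ_n(y)` for every orthonormal basis of `𝓗(Ω)`
    (∀ (ι : Type*) (φ : HilbertBasis ι ℝ (bergmanSpace Ω)), ∀ x ∈ Ω, ∀ y ∈ Ω,
      HasSum (fun n => bergmanRep Ω (φ n) x * bergmanRep Ω (φ n) y)
        (bergmanRep Ω (bergmanKernel Ω x) y)) ∧
    -- the formula for a bounded operator `A : L²(∂Ω) → 𝓗(Ω)`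
    (∀ A : L2Boundary Ω →L[ℝ] bergmanSpace Ω, ∀ v ∈ Set.range A, ∃ g : L2Boundary Ω, ∀ x ∈ Ω,
      Integrable (fun y => (ContinuousLinearMap.adjoint A (bergmanKernel Ω x)) y * g y)
        (surfaceMeasure Ω) ∧
      bergmanRep Ω v x =
        ∫ y, (ContinuousLinearMap.adjoint A (bergmanKernel Ω x)) y * g y ∂(surfaceMeasure Ω)) ∧
    -- Lions' formula: the Dirichlet solution operator `K` has its range in `𝓗(Ω)`, and the formula
    -- holds with `K` in place of `A`
    (∀ K : L2Boundary Ω →L[ℝ] L2Domain Ω, (∀ g, IsVeryWeakDirichletSolution Ω g (K g)) →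
      (∀ g, K g ∈ bergmanSpace Ω) ∧
      ∀ v : bergmanSpace Ω, (v : L2Domain Ω) ∈ Set.range K → ∃ g : L2Boundary Ω, ∀ x ∈ Ω,
        Integrable (fun y =>
          (ContinuousLinearMap.adjoint K (bergmanKernel Ω x : L2Domain Ω)) y * g y)
          (surfaceMeasure Ω) ∧
        bergmanRep Ω v x =
          ∫ y, (ContinuousLinearMap.adjoint K (bergmanKernel Ω x : L2Domain Ω)) y * g y
            ∂(surfaceMeasure Ω)) := by
  have ho := hΩ.isOpen
  have hb := hΩ.isBounded
  refine ⟨bergmanRep_spec ho hb, fun x hx v => bergmanRep_eq_integral ho hb hx v,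
    fun ι φ x hx y hy => hasSum_bergmanRep_mul ho hb φ hx hy, ?_, ?_⟩
  · rintro A _ ⟨g, rfl⟩
    refine ⟨g, fun x hx => ?_⟩
    have hA : inner ℝ (ContinuousLinearMap.adjoint A (bergmanKernel Ω x)) g =
        bergmanRep Ω (A g) x :=
      (ContinuousLinearMap.adjoint_inner_left A g _).trans (inner_bergmanKernel ho hb hx (A g))
    exact (integrable_and_inner_eq_integral_mul _ _).imp_right hA.symm.trans
  · refine fun K hK => ⟨fun g => (hK g).hasWeakLaplacian_zero, ?_⟩
    rintro v ⟨g, hg⟩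
    refine ⟨g, fun x hx => ?_⟩
    have hKv : inner ℝ (ContinuousLinearMap.adjoint K (bergmanKernel Ω x : L2Domain Ω)) g =
        bergmanRep Ω v x := by
      rw [ContinuousLinearMap.adjoint_inner_left K g, hg]
      exact inner_bergmanKernel ho hb hx v
    exact (integrable_and_inner_eq_integral_mul _ _).imp_right hKv.symm.trans
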